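/- Call a family $\mathcal B$ of closed subsets of a topological space $X$ a closed subbase if every closed subset of $X$ is an intersection of finite unions of members of $\mathcal B$ (the empty union being allowed). A closed subbase $\mathcal B$ is binary if $\bigcap\mathcal A\neq\emptyset$ for every $\mathcal A\subseteq\mathcal B$ that is linked, i.e. satisfies $A_0\cap A_1\neq\emptyset$ for all $A_0,A_1\in\mathcal A$ (here $\bigcap\emptyset=X$). A family $\mathcal F$ of subsets of a group $G$ is translation invariant if $gF\in\mathcal F$ whenever $g\in G$ and $F\in\mathcal F$. A space is $0$-dimensional if its clopen subsets form a base. Then every compact Hausdorff Abelian topological group, and every $0$-dimensional compact Hausdorff topological group, has a translation invariant closed binary subbase. -/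

import Mathlib

open scoped Pointwise

/-- A family `ℬ` of subsets of a topological space `X` is a subbase for the closed sets of `X`
(a *closed subbase*): its members are closed, and every closed set is the intersection of a family
of finite unions of members of `ℬ`. The empty union is allowed. -/
def IsClosedSubbase {X : Type*} [TopologicalSpace X] (ℬ : Set (Set X)) : Prop :=
  (∀ B ∈ ℬ, IsClosed B) ∧
    ∀ C : Set X, IsClosed C →
      ∃ 𝒞 : Set (Set X), (∀ D ∈ 𝒞, ∃ ℱ ⊆ ℬ, ℱ.Finite ∧ D = ⋃₀ ℱ) ∧ C = ⋂₀ 𝒞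

/-- A family of sets is *linked* if any two of its members (equal or not) intersect. -/
def IsLinkedFamily {X : Type*} (𝒜 : Set (Set X)) : Prop :=
  ∀ A ∈ 𝒜, ∀ B ∈ 𝒜, (A ∩ B).Nonempty

/-- A family of sets is *binary* if each of its linked subfamilies has nonempty intersection. -/
def IsBinaryFamily {X : Type*} (ℬ : Set (Set X)) : Prop :=
  ∀ 𝒜 ⊆ ℬ, IsLinkedFamily 𝒜 → (⋂₀ 𝒜).Nonempty

/-- A family of subsets of a group is *translation invariant* if it contains `gF` whenever it
contains `F`. -/
def IsTranslationInvariant {G : Type*} [Group G] (ℱ : Set (Set G)) : Prop :=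
  ∀ g : G, ∀ F ∈ ℱ, g • F ∈ ℱ

/-- A topological space is *`0`-dimensional* if its clopen subsets form a base. -/
def IsZeroDimensional (X : Type*) [TopologicalSpace X] : Prop :=
  TopologicalSpace.IsTopologicalBasis {U : Set X | IsClopen U}

/-! An invariant binary family of closed unions of left cosets of a closed subgroup N, separating
these cosets, is refined until N is trivial; by compactness it is then a closed subbase. Zorn's
lemma runs the iteration: unions of chains stay binary by the finite intersection property.

For N ≠ ⊥ take a continuous homomorphism q nontrivial on N and pass to N ⊓ ker q. If q(N) is
discrete, add the q-small sets whose N-saturation already lies in the family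
(`IsCosetSubbase.exists_superset_inf_ker_of_discrete`). If q(N) is the whole circle, add the
q-preimages of short arcs; old members are N-saturated, so old and new conditions can be met
independently (`IsCosetSubbase.inf_ker_of_surjective`). In the Abelian case q is a character,
obtained from Gelfand theory and the regular representation; in the 0-dimensional case it is the
quotient by an open normal subgroup. -/

open Set Filter Topology

/-- A translation invariant binary family of closed sets that are unions of left cosets of `N`,
whose finite unions separate the left cosets of `N`. -/
structure IsCosetSubbase {G : Type*} [Group G] [TopologicalSpace G] (N : Subgroup G)
    (ℬ : Set (Set G)) : Prop where
  isClosed : ∀ B ∈ ℬ, IsClosed B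
  mul_mem : ∀ B ∈ ℬ, ∀ x ∈ B, ∀ n ∈ N, x * n ∈ B
  binary : IsBinaryFamily ℬ
  invariant : IsTranslationInvariant ℬ
  separating : ∀ x y : G, x⁻¹ * y ∉ N →
    ∃ ℱ ⊆ ℬ, ℱ.Finite ∧ ⋃₀ ℱ ∈ 𝓝 y ∧ x ∉ ⋃₀ ℱ

/-- The family of finite intersections of members of `ℬ`. -/
def finiteInters {X : Type*} (ℬ : Set (Set X)) : Set (Set X) :=
  {C | ∃ ℱ ⊆ ℬ, ℱ.Finite ∧ C = ⋂₀ ℱ}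

theorem subset_finiteInters {X : Type*} (ℬ : Set (Set X)) : ℬ ⊆ finiteInters ℬ :=
  fun B hB => ⟨{B}, by simpa using hB, finite_singleton B, by simp⟩

theorem univ_mem_finiteInters {X : Type*} (ℬ : Set (Set X)) : univ ∈ finiteInters ℬ :=
  ⟨∅, empty_subset _, finite_empty, by simp⟩

theorem inter_mem_finiteInters {X : Type*} {ℬ : Set (Set X)} {A B : Set X}
    (hA : A ∈ finiteInters ℬ) (hB : B ∈ finiteInters ℬ) : A ∩ B ∈ finiteInters ℬ := by
  obtain ⟨F, hF, hFf, rfl⟩ := hA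
  obtain ⟨F', hF', hFf', rfl⟩ := hB
  exact ⟨F ∪ F', union_subset hF hF', hFf.union hFf', by rw [sInter_union]⟩

/-- The members of ℬ that contain some element of a linked family are again linked, and their common
points lie in every finite intersection from that family. -/
theorem IsBinaryFamily.finiteInters {X : Type*} {ℬ : Set (Set X)} (h : IsBinaryFamily ℬ) :
    IsBinaryFamily (finiteInters ℬ) := by
  intro 𝒜 h𝒜 hl
  have key : (⋂₀ {B ∈ ℬ | ∃ A ∈ 𝒜, A ⊆ B}).Nonempty := by
    refine h _ (fun B hB => hB.1) ?_
    rintro B ⟨-, A, hA, hAB⟩ B' ⟨-, A', hA', hAB'⟩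
    exact (hl A hA A' hA').mono (inter_subset_inter hAB hAB')
  obtain ⟨x, hx⟩ := key
  refine ⟨x, fun A hA => ?_⟩
  obtain ⟨F, hF, -, rfl⟩ := h𝒜 hA
  exact fun B hB => hx B ⟨hF hB, _, hA, sInter_subset_of_mem hB⟩

theorem IsTranslationInvariant.finiteInters {G : Type*} [Group G] {ℬ : Set (Set G)}
    (h : IsTranslationInvariant ℬ) : IsTranslationInvariant (finiteInters ℬ) := by
  rintro g _ ⟨F, hF, hFf, rfl⟩
  refine ⟨(g • ·) '' F, ?_, hFf.image _, ?_⟩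
  · rintro _ ⟨B, hB, rfl⟩
    exact h g B (hF hB)
  · ext x
    simp only [mem_smul_set_iff_inv_smul_mem, mem_sInter, forall_mem_image]

section

variable {G : Type*} [Group G] [TopologicalSpace G] {N : Subgroup G} {ℬ : Set (Set G)}

theorem IsCosetSubbase.finiteInters (h : IsCosetSubbase N ℬ) :
    IsCosetSubbase N (finiteInters ℬ) where
  isClosed := by
    rintro _ ⟨F, hF, -, rfl⟩
    exact isClosed_sInter fun B hB => h.isClosed B (hF hB)
  mul_mem := by
    rintro _ ⟨F, hF, -, rfl⟩ x hx n hn B hB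
    exact h.mul_mem B (hF hB) x (hx B hB) n hn
  binary := h.binary.finiteInters
  invariant := h.invariant.finiteInters
  separating x y hxy := by
    obtain ⟨F, hF, h'⟩ := h.separating x y hxy
    exact ⟨F, hF.trans (subset_finiteInters _), h'⟩

theorem isCosetSubbase_top : IsCosetSubbase (⊤ : Subgroup G) {univ} where
  isClosed := by rintro _ rfl; exact isClosed_univ
  mul_mem := by rintro _ rfl x - n -; trivial
  binary := by
    intro 𝒜 h𝒜 _
    exact ⟨1, fun A hA => by rw [h𝒜 hA]; trivial⟩
  invariant := by rintro g _ rfl; simp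
  separating x y h := (h trivial).elim

theorem IsCosetSubbase.isClosedSubbase [CompactSpace G] (h : IsCosetSubbase ⊥ ℬ) :
    IsClosedSubbase ℬ := by
  refine ⟨h.isClosed, fun C hC =>
    ⟨{D | (∃ ℱ ⊆ ℬ, ℱ.Finite ∧ D = ⋃₀ ℱ) ∧ C ⊆ D}, fun D hD => hD.1, ?_⟩⟩
  refine Subset.antisymm (subset_sInter fun D hD => hD.2) fun x hx => ?_
  by_contra hxC
  have hsep : ∀ y ∈ C, ∃ ℱ ⊆ ℬ, ℱ.Finite ∧ ⋃₀ ℱ ∈ 𝓝 y ∧ x ∉ ⋃₀ ℱ := fun y hy =>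
    h.separating x y fun hxy => hxC <| by
      rw [Subgroup.mem_bot, inv_mul_eq_one] at hxy
      rwa [hxy]
  choose! ℱ hℱ hfin hnhds hxF using hsep
  obtain ⟨t, ht, hCt⟩ := hC.isCompact.elim_nhds_subcover (fun y => ⋃₀ ℱ y) hnhds
  have hmem : x ∈ ⋃₀ (⋃ y ∈ t, ℱ y) := hx _ ⟨⟨_, iUnion₂_subset fun y hy => hℱ y (ht y hy),
    t.finite_toSet.biUnion fun y hy => hfin y (ht y hy), rfl⟩, by
      simpa only [sUnion_iUnion] using hCt⟩
  simp only [sUnion_iUnion, mem_iUnion] at hmem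
  obtain ⟨y, hy, hxy⟩ := hmem
  exact hxF y (ht y hy) hxy

/-! ### Chains and Zorn's lemma -/

/-- A directed union of binary families of closed sets in a compact space is binary. -/
theorem IsBinaryFamily.sUnion_of_isChain {X : Type*} [TopologicalSpace X] [CompactSpace X]
    {𝒞 : Set (Set (Set X))} (hchain : IsChain (· ⊆ ·) 𝒞) (hne : 𝒞.Nonempty)
    (hclosed : ∀ ℬ ∈ 𝒞, ∀ B ∈ ℬ, IsClosed B) (hbin : ∀ ℬ ∈ 𝒞, IsBinaryFamily ℬ) :
    IsBinaryFamily (⋃₀ 𝒞) := by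
  intro 𝒜 h𝒜 hl
  have key : (univ ∩ ⋂ A : 𝒜, (A : Set X)).Nonempty := by
    refine isCompact_univ.inter_iInter_nonempty _ (fun A => ?_) fun u => ?_
    · obtain ⟨ℬ, hℬ, hA⟩ := h𝒜 A.2
      exact hclosed ℬ hℬ _ hA
    · obtain ⟨ℬ, hℬ, hu⟩ := DirectedOn.exists_mem_subset_of_finset_subset_biUnion (ι := Set (Set X))
        (α := Set X) (f := id) (c := 𝒞) hne
        (by simpa [DirectedOn] using! hchain.directedOn) (s := u.map (Function.Embedding.subtype _))
        (by
          intro A hA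
          obtain ⟨A', -, rfl⟩ := Finset.mem_map.1 hA
          obtain ⟨ℬ, hℬ, hA⟩ := h𝒜 A'.2
          exact mem_biUnion hℬ hA)
      obtain ⟨x, hx⟩ := hbin ℬ hℬ (u.map (Function.Embedding.subtype _) : Finset (Set X)) hu (by
        intro A hA B hB
        obtain ⟨A', -, rfl⟩ := Finset.mem_map.1 hA
        obtain ⟨B', -, rfl⟩ := Finset.mem_map.1 hB
        exact hl _ A'.2 _ B'.2)
      refine ⟨x, trivial, mem_iInter₂.2 fun A hA => hx A ?_⟩
      exact Finset.mem_coe.2 (Finset.mem_map.2 ⟨A, hA, rfl⟩)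
  obtain ⟨x, -, hx⟩ := key
  exact ⟨x, fun A hA => mem_iInter.1 hx ⟨A, hA⟩⟩

theorem isCosetSubbase_of_isChain [CompactSpace G]
    {c : Set ((Subgroup G)ᵒᵈ × Set (Set G))} (hc : IsChain (· ≤ ·) c) (hne : c.Nonempty)
    (h : ∀ p ∈ c, IsCosetSubbase (OrderDual.ofDual p.1) p.2) :
    IsCosetSubbase (sInf ((fun p => OrderDual.ofDual p.1) '' c)) (⋃₀ (Prod.snd '' c)) where
  isClosed := by
    rintro B ⟨_, ⟨p, hp, rfl⟩, hB⟩
    exact (h p hp).isClosed B hB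
  mul_mem := by
    rintro B ⟨_, ⟨p, hp, rfl⟩, hB⟩ x hx n hn
    exact (h p hp).mul_mem B hB x hx n (Subgroup.mem_sInf.1 hn _ ⟨p, hp, rfl⟩)
  binary := by
    refine IsBinaryFamily.sUnion_of_isChain ?_ (hne.image _) ?_ ?_
    · exact hc.image_of_map_rel _ _ Prod.snd (fun p q hpq => hpq.2)
    · rintro _ ⟨p, hp, rfl⟩
      exact (h p hp).isClosed
    · rintro _ ⟨p, hp, rfl⟩
      exact (h p hp).binary
  invariant := by
    rintro g B ⟨_, ⟨p, hp, rfl⟩, hB⟩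
    exact ⟨_, ⟨p, hp, rfl⟩, (h p hp).invariant g B hB⟩
  separating x y hxy := by
    simp only [Subgroup.mem_sInf, forall_mem_image, not_forall] at hxy
    obtain ⟨p, hp, hxy⟩ := hxy
    obtain ⟨F, hF, h'⟩ := (h p hp).separating x y hxy
    exact ⟨F, hF.trans (subset_sUnion_of_mem ⟨p, hp, rfl⟩), h'⟩

theorem exists_isCosetSubbase_bot [CompactSpace G]
    (step : ∀ (N : Subgroup G) (ℬ : Set (Set G)), IsClosed (N : Set G) → IsCosetSubbase N ℬ →
      N ≠ ⊥ → ∃ N' < N, IsClosed (N' : Set G) ∧ ∃ ℬ', ℬ ⊆ ℬ' ∧ IsCosetSubbase N' ℬ') :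
    ∃ ℬ : Set (Set G), IsCosetSubbase ⊥ ℬ := by
  -- The order dual makes going up mean a smaller subgroup together with a larger family.
  let S : Set ((Subgroup G)ᵒᵈ × Set (Set G)) :=
    {p | IsClosed ((OrderDual.ofDual p.1 : Subgroup G) : Set G) ∧
      IsCosetSubbase (OrderDual.ofDual p.1) p.2}
  have ih : ∀ c ⊆ S, IsChain (· ≤ ·) c → ∀ p ∈ c, ∃ ub ∈ S, ∀ q ∈ c, q ≤ ub := by
    intro c hcs hc p hp
    have hchain := isCosetSubbase_of_isChain hc ⟨p, hp⟩ fun q hq => (hcs hq).2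
    have hle : ∀ q ∈ c, sInf ((fun p => OrderDual.ofDual p.1) '' c : Set (Subgroup G)) ≤
        OrderDual.ofDual q.1 := fun q hq => sInf_le ⟨q, hq, rfl⟩
    have hclosed : IsClosed ((sInf ((fun p => OrderDual.ofDual p.1) '' c : Set (Subgroup G)) :
        Subgroup G) : Set G) := by
      rw [Subgroup.coe_sInf]
      refine isClosed_biInter ?_
      rintro _ ⟨q, hq, rfl⟩
      exact (hcs hq).1
    generalize sInf ((fun p => OrderDual.ofDual p.1) '' c : Set (Subgroup G)) = N at *
    exact ⟨(OrderDual.toDual N, ⋃₀ (Prod.snd '' c)), ⟨hclosed, hchain⟩,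
      fun q hq => ⟨hle q hq, subset_sUnion_of_mem ⟨q, hq, rfl⟩⟩⟩
  obtain ⟨m, -, hm⟩ := zorn_le_nonempty₀ S ih
    (OrderDual.toDual ⊤, {univ}) ⟨isClosed_univ, isCosetSubbase_top⟩
  by_cases hbot : OrderDual.ofDual m.1 = ⊥
  · exact ⟨m.2, hbot ▸ hm.1.2⟩
  · obtain ⟨N', hlt, hcl, ℬ', hℬ', h'⟩ := step _ _ hm.1.1 hm.1.2 hbot
    have := hm.2 (y := (OrderDual.toDual N', ℬ')) ⟨hcl, h'⟩ ⟨hlt.le, hℬ'⟩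
    exact absurd (show OrderDual.ofDual m.1 ≤ N' from this.1) hlt.not_ge

theorem exists_binary_subbase_of_step [CompactSpace G]
    (step : ∀ (N : Subgroup G) (ℬ : Set (Set G)), IsClosed (N : Set G) → IsCosetSubbase N ℬ →
      N ≠ ⊥ → ∃ N' < N, IsClosed (N' : Set G) ∧ ∃ ℬ', ℬ ⊆ ℬ' ∧ IsCosetSubbase N' ℬ') :
    ∃ ℬ : Set (Set G), IsClosedSubbase ℬ ∧ IsBinaryFamily ℬ ∧ IsTranslationInvariant ℬ := by
  obtain ⟨ℬ, h⟩ := exists_isCosetSubbase_bot step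
  exact ⟨ℬ, h.isClosedSubbase, h.binary, h.invariant⟩

end

/-! ### Refinement along a homomorphism -/

section

variable {G : Type*} [Group G] [TopologicalSpace G] {N : Subgroup G} {ℬ : Set (Set G)}

/-- By separation, the neighbourhoods of y that are finite unions from ℬ intersect inside yN. They
are closed and, by `hinter`, directed, so compactness puts one of them inside V. -/
theorem IsCosetSubbase.exists_sUnion_mem_nhds_subset [CompactSpace G] (h : IsCosetSubbase N ℬ)
    (huniv : univ ∈ ℬ) (hinter : ∀ A ∈ ℬ, ∀ B ∈ ℬ, A ∩ B ∈ ℬ) {V : Set G} (hV : IsOpen V) {y : G}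
    (hy : ∀ n ∈ N, y * n ∈ V) :
    ∃ ℱ ⊆ ℬ, ℱ.Finite ∧ ⋃₀ ℱ ∈ 𝓝 y ∧ ⋃₀ ℱ ⊆ V := by
  let ι := {ℱ : Set (Set G) // ℱ ⊆ ℬ ∧ ℱ.Finite ∧ ⋃₀ ℱ ∈ 𝓝 y}
  have : Nonempty ι := ⟨⟨{univ}, by simpa using huniv, finite_singleton _, by simp⟩⟩
  obtain ⟨⟨ℱ, hℱ, hfin, hnhds⟩, hi⟩ := hV.isClosed_compl.isCompact.elim_directed_family_closed
    (fun ℱ : ι => ⋃₀ (ℱ : Set (Set G)))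
    (fun ℱ => by
      rw [sUnion_eq_biUnion]
      exact Set.Finite.isClosed_biUnion ℱ.2.2.1 fun B hB => h.isClosed B (ℱ.2.1 hB))
    (by
      refine eq_empty_iff_forall_notMem.2 fun z hz => hz.1 ?_
      by_contra hzV
      have hzy : z⁻¹ * y ∉ N := fun hzy => hz.1 <| by
        simpa [mul_assoc] using hy _ (N.inv_mem hzy)
      obtain ⟨ℱ, hℱ, hfin, hnhds, hzF⟩ := h.separating z y hzy
      exact hzF (mem_iInter.1 hz.2 ⟨ℱ, hℱ, hfin, hnhds⟩))
    (by
      rintro ⟨ℱ, hℱ, hfin, hnhds⟩ ⟨ℱ', hℱ', hfin', hnhds'⟩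
      have heq : ⋃₀ image2 (· ∩ ·) ℱ ℱ' = ⋃₀ ℱ ∩ ⋃₀ ℱ' := by
        ext x
        simp only [mem_sUnion, mem_image2, mem_inter_iff]
        constructor
        · rintro ⟨_, ⟨A, hA, B, hB, rfl⟩, hxA, hxB⟩
          exact ⟨⟨A, hA, hxA⟩, ⟨B, hB, hxB⟩⟩
        · rintro ⟨⟨A, hA, hxA⟩, ⟨B, hB, hxB⟩⟩
          exact ⟨_, ⟨A, hA, B, hB, rfl⟩, hxA, hxB⟩
      refine ⟨⟨image2 (· ∩ ·) ℱ ℱ', ?_, hfin.image2 _ hfin', ?_⟩, ?_, ?_⟩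
      · rintro _ ⟨A, hA, B, hB, rfl⟩
        exact hinter A (hℱ hA) B (hℱ' hB)
      · rw [heq]
        exact inter_mem hnhds hnhds'
      · exact heq.subset.trans inter_subset_left
      · exact heq.subset.trans inter_subset_right)
  refine ⟨ℱ, hℱ, hfin, hnhds, fun x hx => ?_⟩
  by_contra hxV
  exact (eq_empty_iff_forall_notMem.1 hi) x ⟨hxV, hx⟩

variable {Q : Type*} [Group Q] [TopologicalSpace Q]

theorem exists_isClosed_nhds_one_inv_mul_mem [IsTopologicalGroup Q] {E : Set Q}
    (hE : E ∈ 𝓝 (1 : Q)) :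
    ∃ P ∈ 𝓝 (1 : Q), IsClosed P ∧ ∀ v ∈ P, ∀ w ∈ P, v⁻¹ * w ∈ E := by
  obtain ⟨V, hV, hVE⟩ := exists_nhds_split_inv hE
  obtain ⟨P, hP, hPc, hPV⟩ := exists_mem_nhds_isClosed_subset (inv_mem_nhds_one Q hV)
  refine ⟨P, hP, hPc, fun v hv w hw => ?_⟩
  simpa using hVE _ (hPV hv) _ (hPV hw)

theorem IsCosetSubbase.exists_superset_inf_ker_of_discrete [CompactSpace G] [IsTopologicalGroup G]
    [IsTopologicalGroup Q] (h : IsCosetSubbase N ℬ) (q : G →* Q) (hq : Continuous q) {D : Set Q}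
    (hD : D ∈ 𝓝 (1 : Q)) (hDN : ∀ n ∈ N, q n ∈ D → q n = 1) :
    ∃ ℬ', ℬ ⊆ ℬ' ∧ IsCosetSubbase (N ⊓ q.ker) ℬ' := by
  wlog hfi : univ ∈ ℬ ∧ ∀ A ∈ ℬ, ∀ B ∈ ℬ, A ∩ B ∈ ℬ
  · obtain ⟨ℬ', hsub, h'⟩ := this h.finiteInters q hq hD hDN
      ⟨univ_mem_finiteInters ℬ, fun A hA B hB => inter_mem_finiteInters hA hB⟩
    exact ⟨ℬ', (subset_finiteInters ℬ).trans hsub, h'⟩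
  obtain ⟨E, hE, hED⟩ := exists_nhds_one_split hD
  obtain ⟨P, hP, hPc, hPE⟩ := exists_isClosed_nhds_one_inv_mul_mem hE
  -- Smallness is measured by E with E·E ⊆ D: chaining through one common point of two such sets
  -- lands in D, where q is trivial on N.
  let 𝒮 : Set (Set G) := {S | IsClosed S ∧ (∀ x ∈ S, ∀ n ∈ N ⊓ q.ker, x * n ∈ S) ∧
    S * (N : Set G) ∈ ℬ ∧ ∀ x ∈ S, ∀ y ∈ S, q (x⁻¹ * y) ∈ E}
  have hsub : ∀ S : Set G, S ⊆ S * (N : Set G) := fun S x hx =>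
    ⟨x, hx, 1, N.one_mem, mul_one x⟩
  refine ⟨ℬ ∪ 𝒮, subset_union_left, ?_, ?_, ?_, ?_, ?_⟩
  · rintro B (hB | hB)
    exacts [h.isClosed B hB, hB.1]
  · rintro B (hB | hB) x hx n hn
    exacts [h.mul_mem B hB x hx n hn.1, hB.2.1 x hx n hn]
  · intro 𝒜 h𝒜 hl
    obtain ⟨x, hx⟩ : (⋂₀ {B ∈ ℬ | ∃ A ∈ 𝒜, A ⊆ B}).Nonempty := by
      refine h.binary _ (fun B hB => hB.1) ?_
      rintro B ⟨-, A, hA, hAB⟩ B' ⟨-, A', hA', hAB'⟩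
      exact (hl A hA A' hA').mono (inter_subset_inter hAB hAB')
    by_cases hS : ∃ S ∈ 𝒜, S ∈ 𝒮
    · obtain ⟨S, hS𝒜, hS⟩ := hS
      -- Move x inside its coset xN to a point s of one new set S. Old members still contain s;
      -- every other new set meets xN and S, which forces it to contain s too.
      obtain ⟨s, hs, n, hn, hsn⟩ : x ∈ S * (N : Set G) := hx _ ⟨hS.2.2.1, S, hS𝒜, hsub S⟩
      have hsx : s = x * n⁻¹ := by rw [← hsn]; simp
      refine ⟨s, fun A hA => ?_⟩
      rcases h𝒜 hA with hAℬ | hA𝒮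
      · rw [hsx]
        exact h.mul_mem A hAℬ x (hx A ⟨hAℬ, A, hA, Subset.rfl⟩) _ (N.inv_mem hn)
      · obtain ⟨a, ha, m, hm, ham⟩ : x ∈ A * (N : Set G) := hx _ ⟨hA𝒮.2.2.1, A, hA, hsub A⟩
        obtain ⟨z, hzS, hzA⟩ := hl S hS𝒜 A hA
        have hN : a⁻¹ * s ∈ N := by
          have : a⁻¹ * s = m * n⁻¹ := by
            rw [hsx, ← ham]
            simp [mul_assoc]
          rw [this]
          exact N.mul_mem hm (N.inv_mem hn)
        have hqD : q (a⁻¹ * s) ∈ D := by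
          have := hED _ (hA𝒮.2.2.2 a ha z hzA) _ (hS.2.2.2 z hzS s hs)
          rwa [← map_mul, mul_assoc, mul_inv_cancel_left] at this
        have := hA𝒮.2.1 a ha (a⁻¹ * s) ⟨hN, hDN _ hN hqD⟩
        rwa [mul_inv_cancel_left] at this
    · refine ⟨x, fun A hA => ?_⟩
      rcases h𝒜 hA with hAℬ | hA𝒮
      · exact hx A ⟨hAℬ, A, hA, Subset.rfl⟩
      · exact (hS ⟨A, hA, hA𝒮⟩).elim
  · rintro g B (hB | hB)
    · exact Or.inl (h.invariant g B hB)
    · refine Or.inr ⟨hB.1.smul g, ?_, ?_, ?_⟩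
      · rintro _ ⟨x, hx, rfl⟩ n hn
        exact ⟨x * n, hB.2.1 x hx n hn, by simp [mul_assoc]⟩
      · rw [smul_mul_assoc]
        exact h.invariant g _ hB.2.2.1
      · rintro _ ⟨x, hx, rfl⟩ _ ⟨y, hy, rfl⟩
        simpa [mul_assoc] using hB.2.2.2 x hx y hy
  · intro x y hxy
    by_cases hN : x⁻¹ * y ∈ N
    swap
    · obtain ⟨F, hF, h'⟩ := h.separating x y hN
      exact ⟨F, hF.trans subset_union_left, h'⟩
    let Y : Set G := {z | q (y⁻¹ * z) ∈ P}
    have hcont : Continuous fun z => q (y⁻¹ * z) := hq.comp (continuous_const.mul continuous_id)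
    have hYc : IsClosed Y := hPc.preimage hcont
    have hYn : Y ∈ 𝓝 y := hcont.continuousAt.preimage_mem_nhds (by simpa using hP)
    obtain ⟨F, hF, hFf, hFn, hFV⟩ := h.exists_sUnion_mem_nhds_subset hfi.1 hfi.2
      -- Any B ∈ ℬ inside `interior Y * N` is recovered as the N-saturation of B ∩ Y, so B ∩ Y
      -- belongs to 𝒮.
      (V := interior Y * (N : Set G)) isOpen_interior.mul_right (y := y)
      fun n hn => mul_mem_mul (mem_interior_iff_mem_nhds.2 hYn) hn
    refine ⟨(· ∩ Y) '' F, ?_, hFf.image _, ?_, ?_⟩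
    · rintro _ ⟨B, hB, rfl⟩
      refine Or.inr ⟨(h.isClosed B (hF hB)).inter hYc, ?_, ?_, ?_⟩
      · rintro z ⟨hzB, hzY⟩ n hn
        refine ⟨h.mul_mem B (hF hB) z hzB n hn.1, ?_⟩
        change q (y⁻¹ * (z * n)) ∈ P
        rwa [← mul_assoc, map_mul, (MonoidHom.mem_ker.1 hn.2), mul_one]
      · convert hF hB using 1
        refine Subset.antisymm ?_ fun b hb => ?_
        · rintro _ ⟨z, hz, n, hn, rfl⟩
          exact h.mul_mem B (hF hB) z hz.1 n hn
        · obtain ⟨z, hz, n, hn, rfl⟩ := hFV ⟨B, hB, hb⟩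
          refine ⟨z, ⟨?_, interior_subset hz⟩, n, hn, rfl⟩
          simpa using h.mul_mem B (hF hB) _ hb _ (N.inv_mem hn)
      · rintro z ⟨-, hz⟩ w ⟨-, hw⟩
        have := hPE _ hz _ hw
        rwa [← map_inv, ← map_mul, mul_inv_rev, inv_inv, mul_assoc, mul_inv_cancel_left] at this
    · rw [sUnion_image, ← iUnion₂_inter, ← sUnion_eq_biUnion]
      exact inter_mem hFn hYn
    · rintro ⟨_, ⟨B, -, rfl⟩, -, hxY⟩
      have h1 : q (x⁻¹ * y) ∈ D := by
        have h1P : (1 : Q) ∈ P := mem_of_mem_nhds hP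
        have := hED _ (hPE _ hxY _ h1P) 1 (mem_of_mem_nhds hE)
        simpa using this
      exact hxy ⟨hN, hDN _ hN h1⟩

theorem IsCosetSubbase.inf_ker_of_surjective (h : IsCosetSubbase N ℬ) (q : G →* Q)
    (hq : Continuous q) (hsurj : ∀ t, ∃ n ∈ N, q n = t) {𝒞 : Set (Set Q)}
    (h𝒞 : IsCosetSubbase ⊥ 𝒞) :
    IsCosetSubbase (N ⊓ q.ker) (ℬ ∪ (q ⁻¹' ·) '' 𝒞) where
  isClosed := by
    rintro B (hB | ⟨C, hC, rfl⟩)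
    exacts [h.isClosed B hB, (h𝒞.isClosed C hC).preimage hq]
  mul_mem := by
    rintro B (hB | ⟨C, hC, rfl⟩) x hx n hn
    · exact h.mul_mem B hB x hx n hn.1
    · change q (x * n) ∈ C
      rwa [map_mul, MonoidHom.mem_ker.1 hn.2, mul_one]
  binary := by
    intro 𝒜 h𝒜 hl
    obtain ⟨x, hx⟩ : (⋂₀ (𝒜 ∩ ℬ)).Nonempty :=
      h.binary _ inter_subset_right fun A hA B hB => hl A hA.1 B hB.1
    obtain ⟨t, ht⟩ : (⋂₀ {C ∈ 𝒞 | q ⁻¹' C ∈ 𝒜}).Nonempty := by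
      refine h𝒞.binary _ (fun C hC => hC.1) fun A hA B hB => ?_
      obtain ⟨z, hz⟩ := hl _ hA.2 _ hB.2
      exact ⟨q z, hz⟩
    obtain ⟨n, hn, hqn⟩ := hsurj ((q x)⁻¹ * t)
    refine ⟨x * n, fun A hA => ?_⟩
    rcases h𝒜 hA with hAℬ | ⟨C, hC, rfl⟩
    · exact h.mul_mem A hAℬ x (hx A ⟨hA, hAℬ⟩) n hn
    · change q (x * n) ∈ C
      rw [map_mul, hqn, mul_inv_cancel_left]
      exact ht C ⟨hC, hA⟩
  invariant := by
    rintro g B (hB | ⟨C, hC, rfl⟩)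
    · exact Or.inl (h.invariant g B hB)
    · refine Or.inr ⟨q g • C, h𝒞.invariant _ C hC, ?_⟩
      ext x
      simp [mem_smul_set_iff_inv_smul_mem]
  separating x y hxy := by
    by_cases hN : x⁻¹ * y ∈ N
    · have hqxy : (q x)⁻¹ * q y ∉ (⊥ : Subgroup Q) := fun hmem => hxy ⟨hN, by
        simpa using hmem⟩
      obtain ⟨F, hF, hFf, hFn, hxF⟩ := h𝒞.separating _ _ hqxy
      have heq : ⋃₀ ((q ⁻¹' ·) '' F) = q ⁻¹' ⋃₀ F := by
        rw [sUnion_image, preimage_sUnion]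
      refine ⟨(q ⁻¹' ·) '' F, (image_mono hF).trans subset_union_right, hFf.image _, ?_, ?_⟩
      · rw [heq]
        exact hq.continuousAt.preimage_mem_nhds hFn
      · rwa [heq]
    · obtain ⟨F, hF, h'⟩ := h.separating x y hN
      exact ⟨F, hF.trans subset_union_left, h'⟩

end

/-! ### Arcs and closed subgroups of the circle -/

theorem Circle.image_exp_Icc_mem_nhds {a b t : ℝ} (hat : a < t) (htb : t < b) :
    Circle.exp '' Icc a b ∈ 𝓝 (Circle.exp t) :=
  isLocalHomeomorph_circleExp.isOpenMap.image_mem_nhds (Icc_mem_nhds hat htb)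

/-- The family of arcs of the circle of length at most one. -/
def shortArcs : Set (Set Circle) :=
  {I | ∃ a b : ℝ, b - a ≤ 1 ∧ I = Circle.exp '' Icc a b}

/-- Arcs meeting a fixed one lift to intervals inside an interval of length at most 3 < 2π, where
`Circle.exp` is injective. The lifts therefore intersect pairwise, and the supremum of their left
endpoints is common to all. -/
theorem isBinaryFamily_shortArcs : IsBinaryFamily shortArcs := by
  intro 𝒜 h𝒜 hl
  rcases 𝒜.eq_empty_or_nonempty with rfl | ⟨I₀, hI₀⟩
  · exact ⟨1, by simp⟩
  obtain ⟨a₀, b₀, hab₀, rfl⟩ := h𝒜 hI₀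
  have hpi := Real.pi_gt_three
  have hlift : ∀ I ∈ 𝒜, ∃ a b : ℝ, a ≤ b ∧ I = Circle.exp '' Icc a b ∧
      a₀ - 1 ≤ a ∧ b ≤ b₀ + 1 := by
    intro I hI
    obtain ⟨a, b, hab, rfl⟩ := h𝒜 hI
    obtain ⟨_, ⟨s, hs, rfl⟩, ⟨t, ht, hst⟩⟩ := hl _ hI _ hI₀
    obtain ⟨m, hm⟩ := Circle.exp_eq_exp.1 hst
    refine ⟨a + m * (2 * Real.pi), b + m * (2 * Real.pi), by linarith [hs.1, hs.2], ?_,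
      by linarith [hs.2, ht.1], by linarith [hs.1, ht.2]⟩
    rw [← image_add_const_Icc, image_image]
    refine image_congr fun x _ => ?_
    exact (Circle.exp_eq_exp.2 ⟨m, rfl⟩).symm
  choose! a b hab hI ha hb using hlift
  have key : ∀ I ∈ 𝒜, ∀ J ∈ 𝒜, a I ≤ b J := by
    intro I hIA J hJA
    have hne := hl I hIA J hJA
    rw [hI I hIA, hI J hJA] at hne
    obtain ⟨_, ⟨s, hs, rfl⟩, ⟨t, ht, hst⟩⟩ := hne
    have hinj : InjOn Circle.exp (Icc (a₀ - 1) (b₀ + 1)) :=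
      Circle.exp_injOn_Icc (by linarith)
    have := hinj ⟨by linarith [ha J hJA, ht.1], by linarith [hb J hJA, ht.2]⟩
      ⟨by linarith [ha I hIA, hs.1], by linarith [hb I hIA, hs.2]⟩ hst
    rw [this] at ht
    exact hs.1.trans ht.2
  refine ⟨Circle.exp (sSup (a '' 𝒜)), fun I hIA => ?_⟩
  have hbdd : BddAbove (a '' 𝒜) := ⟨b I, by
    rintro _ ⟨J, hJ, rfl⟩
    exact key J hJ I hIA⟩
  have hmem : sSup (a '' 𝒜) ∈ Icc (a I) (b I) := by
    refine ⟨le_csSup hbdd ⟨I, hIA, rfl⟩, csSup_le ⟨_, I, hIA, rfl⟩ ?_⟩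
    rintro _ ⟨J, hJ, rfl⟩
    exact key J hJ I hIA
  rw [hI I hIA]
  exact mem_image_of_mem _ hmem

theorem isCosetSubbase_shortArcs : IsCosetSubbase ⊥ shortArcs where
  isClosed := by
    rintro _ ⟨a, b, -, rfl⟩
    exact (isCompact_Icc.image Circle.exp.continuous).isClosed
  mul_mem := by
    rintro B - x hx n hn
    rwa [Subgroup.mem_bot.1 hn, mul_one]
  binary := isBinaryFamily_shortArcs
  invariant := by
    rintro g _ ⟨a, b, hab, rfl⟩
    obtain ⟨t, rfl⟩ := Circle.exp_surjective g
    refine ⟨t + a, t + b, by linarith, ?_⟩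
    rw [← image_const_add_Icc, image_image, ← image_smul, image_image]
    exact image_congr fun x _ => (Circle.exp_add t x).symm
  separating x y hxy := by
    have hne : x ≠ y := fun h => hxy (by simp [h])
    obtain ⟨t, rfl⟩ := Circle.exp_surjective y
    obtain ⟨u, hu, hu'⟩ : ∃ u, |u - t| ≤ Real.pi ∧ Circle.exp u = x := by
      refine ⟨t + Complex.arg (x / Circle.exp t : Circle), ?_, ?_⟩
      · simpa using Complex.abs_arg_le_pi _
      · rw [Circle.exp_add, Circle.exp_arg, mul_div_cancel]
    have hut : 0 < |u - t| := abs_pos.2 fun h => hne (by rw [← hu', sub_eq_zero.1 h])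
    -- The first bound keeps u out of the interval; the second keeps the arc short and rules out
    -- other lifts of x, since 1/2 + π < 2π.
    set ε := min (|u - t| / 2) (1 / 2) with hε
    have hε0 : 0 < ε := lt_min (by linarith) (by norm_num)
    have hε1 : ε ≤ |u - t| / 2 := min_le_left _ _
    have hε2 : ε ≤ 1 / 2 := min_le_right _ _
    refine ⟨{Circle.exp '' Icc (t - ε) (t + ε)}, ?_, finite_singleton _, ?_, ?_⟩
    · rintro _ rfl
      exact ⟨_, _, by linarith, rfl⟩
    · rw [sUnion_singleton]
      exact Circle.image_exp_Icc_mem_nhds (by linarith) (by linarith)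
    · rw [sUnion_singleton]
      rintro ⟨v, hv, hvx⟩
      rw [← hu', Circle.exp_eq_exp] at hvx
      obtain ⟨m, hm⟩ := hvx
      have hpi := Real.pi_gt_three
      have hvt : |v - t| ≤ ε := abs_le.2 ⟨by linarith [hv.1], by linarith [hv.2]⟩
      have hm0 : m = 0 := by
        have h1 : |(m : ℝ) * (2 * Real.pi)| < 2 * Real.pi := by
          have : (m : ℝ) * (2 * Real.pi) = (v - t) - (u - t) := by linarith
          rw [this]
          calc _ ≤ |v - t| + |u - t| := abs_sub _ _
            _ < _ := by linarith
        rw [abs_mul, abs_of_pos (by positivity : 0 < 2 * Real.pi)] at h1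
        have h2 : |(m : ℝ)| < 1 := by
          by_contra hcon
          nlinarith [Real.pi_pos]
        have h3 : |m| < 1 := by exact_mod_cast h2
        exact Int.abs_lt_one_iff.1 h3
      rw [hm0] at hm
      have : v = u := by simpa using hm
      rw [this] at hvt
      linarith

/-- A closed subgroup of the circle is discrete or the whole circle. -/
theorem Circle.subgroup_discrete_or_eq_top (H : Subgroup Circle) (hH : IsClosed (H : Set Circle)) :
    (∃ D ∈ 𝓝 (1 : Circle), ∀ z ∈ H, z ∈ D → z = 1) ∨ H = ⊤ := by
  let S : AddSubgroup ℝ :=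
    { carrier := {t | Circle.exp t ∈ H}
      add_mem' := fun {s t} hs ht => by
        change Circle.exp (s + t) ∈ H
        rw [Circle.exp_add]
        exact H.mul_mem hs ht
      zero_mem' := by simp
      neg_mem' := fun {s} hs => by
        change Circle.exp (-s) ∈ H
        rw [Circle.exp_neg]
        exact H.inv_mem hs }
  rcases S.dense_or_cyclic with hd | ⟨a, ha⟩
  · refine Or.inr (eq_top_iff.2 fun z _ => ?_)
    have hcl : IsClosed (S : Set ℝ) := hH.preimage Circle.exp.continuous
    obtain ⟨t, rfl⟩ := Circle.exp_surjective z
    have : t ∈ (S : Set ℝ) := by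
      rw [← hcl.closure_eq, hd.closure_eq]
      trivial
    exact this
  -- The lifted group contains 2π, so its generator is nonzero; half of it then bounds an arc that
  -- isolates 1.
  · have ha0 : a ≠ 0 := by
      rintro rfl
      have h2 : 2 * Real.pi ∈ S := by
        change Circle.exp (2 * Real.pi) ∈ H
        simp
      rw [ha, AddSubgroup.mem_closure_singleton] at h2
      obtain ⟨m, hm⟩ := h2
      rw [smul_zero] at hm
      linarith [Real.pi_pos]
    have ha0' : 0 < |a| := abs_pos.2 ha0
    refine Or.inl ⟨Circle.exp '' Icc (-(|a| / 2)) (|a| / 2), ?_, ?_⟩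
    · rw [← Circle.exp_zero]
      exact Circle.image_exp_Icc_mem_nhds (by linarith) (by linarith)
    · rintro _ hz ⟨t, ht, rfl⟩
      have htS : t ∈ S := hz
      rw [ha, AddSubgroup.mem_closure_singleton] at htS
      obtain ⟨m, rfl⟩ := htS
      have h1 : |(m : ℝ)| * |a| ≤ |a| / 2 := by
        rw [← abs_mul, ← zsmul_eq_mul]
        exact abs_le.2 ht
      have h2 : |(m : ℝ)| < 1 := by
        by_contra hcon
        nlinarith
      have h3 : |m| < 1 := by exact_mod_cast h2
      rw [Int.abs_lt_one_iff.1 h3]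
      simp

/-! ### Characters of compact Abelian groups -/

/-- The double centralizer of S is a commutative C⋆-algebra, so the Gelfand transform is injective
on it. -/
theorem exists_starAlgHom_apply_ne_zero {A : Type*} [CStarAlgebra A] (S : Set A)
    (hstar : ∀ a ∈ S, star a ∈ S) (hcomm : ∀ a ∈ S, ∀ b ∈ S, a * b = b * a) :
    ∃ B : StarSubalgebra ℂ A, S ⊆ B ∧
      ∀ b : B, b ≠ 0 → ∃ ψ : B →⋆ₐ[ℂ] ℂ, Continuous ψ ∧ ψ b ≠ 0 := by
  let C := StarSubalgebra.centralizer ℂ S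
  let B := StarSubalgebra.centralizer ℂ (C : Set A)
  have hSC : S ⊆ C := fun a ha => (StarSubalgebra.mem_centralizer_iff ℂ).2 fun g hg =>
    ⟨hcomm g hg a ha, hcomm _ (hstar g hg) a ha⟩
  have hSB : S ⊆ B := fun a ha => (StarSubalgebra.mem_centralizer_iff ℂ).2 fun g hg =>
    ⟨(((StarSubalgebra.mem_centralizer_iff ℂ).1 hg a ha).1).symm,
      (((StarSubalgebra.mem_centralizer_iff ℂ).1 (star_mem hg) a ha).1).symm⟩
  have hBC : B ≤ C := StarSubalgebra.centralizer_le ℂ _ _ hSC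
  have hclosed : IsClosed (B : Set A) := by
    rw [StarSubalgebra.coe_centralizer]
    exact Set.isClosed_centralizer _
  have hmul : ∀ x y : B, x * y = y * x := fun x y => Subtype.ext
    (((StarSubalgebra.mem_centralizer_iff ℂ).1 y.2 x (hBC x.2)).1)
  have : CompleteSpace B := hclosed.completeSpace_coe
  let _ : CommCStarAlgebra B := { (inferInstance : CStarAlgebra B) with mul_comm := hmul }
  refine ⟨B, hSB, fun b hb => ?_⟩
  have hne : gelfandStarTransform B b ≠ 0 := by
    simpa using hb
  obtain ⟨φ, hφ⟩ := DFunLike.ne_iff.1 hne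
  let ψ : B →⋆ₐ[ℂ] ℂ := { (AlgHomClass.toAlgHom φ : B →ₐ[ℂ] ℂ) with map_star' := map_star φ }
  exact ⟨ψ, map_continuous φ, hφ⟩

theorem exists_continuousMonoidHom_circle_of_unitary_rep {G A : Type*} [CommGroup G]
    [TopologicalSpace G] [CStarAlgebra A] (π : G →* A) (hπ : ∀ g, star (π g) = π g⁻¹)
    (T : A) (hT : star T = T) (hcomm : ∀ g, π g * T = T * π g)
    (hcont : Continuous fun g => π g * T) {a : G} (ha : π a * T ≠ T) :
    ∃ χ : G →* Circle, Continuous χ ∧ χ a ≠ 1 := by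
  obtain ⟨B, hSB, hB⟩ := exists_starAlgHom_apply_ne_zero (insert T (range π))
    (by
      rintro _ (rfl | ⟨g, rfl⟩)
      · rw [hT]
        exact mem_insert _ _
      · rw [hπ]
        exact mem_insert_of_mem _ ⟨_, rfl⟩)
    (by
      rintro _ (rfl | ⟨g, rfl⟩) _ (rfl | ⟨h, rfl⟩)
      · rfl
      · exact (hcomm h).symm
      · exact hcomm g
      · rw [← map_mul, ← map_mul, mul_comm])
  have hTB : T ∈ B := hSB (mem_insert _ _)
  have hπB : ∀ g, π g ∈ B := fun g => hSB (mem_insert_of_mem _ ⟨g, rfl⟩)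
  let T' : B := ⟨T, hTB⟩
  let π' : G →* B := π.codRestrict B hπB
  obtain ⟨ψ, hψc, hψ⟩ := hB (π' a * T' - T')
    (fun h => ha (sub_eq_zero.1 (congrArg Subtype.val h)))
  have hψ' : (ψ (π' a) - 1) * ψ T' ≠ 0 := by
    rwa [sub_mul, one_mul, ← map_mul, ← map_sub]
  have hunit : ∀ g, ‖ψ (π' g)‖ = 1 := by
    intro g
    have h1 : star (π' g) = π' g⁻¹ := Subtype.ext (hπ g)
    have h2 : star (ψ (π' g)) * ψ (π' g) = 1 := by
      rw [← map_star, h1, ← map_mul, ← map_mul, inv_mul_cancel, map_one, map_one]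
    have h3 := CStarRing.norm_star_mul_self (x := ψ (π' g))
    rw [h2, norm_one] at h3
    nlinarith [norm_nonneg (ψ (π' g))]
  refine ⟨⟨⟨fun g => ⟨ψ (π' g), mem_sphere_zero_iff_norm.2 (hunit g)⟩, ?_⟩, ?_⟩, ?_, ?_⟩
  · ext
    simp
  · intro g h
    ext
    simp only [map_mul]
    rfl
  · refine continuous_induced_rng.2 ?_
    -- π itself need not be norm continuous; multiplying by T repairs this, and ψ T' ≠ 0 can be
    -- divided out.
    have heq : (fun g => ψ (π' g)) = fun g => ψ (π' g * T') / ψ T' := by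
      ext g
      rw [map_mul, mul_div_cancel_right₀ _ (right_ne_zero_of_mul hψ')]
    change Continuous fun g => ψ (π' g)
    rw [heq]
    exact (hψc.comp (continuous_induced_rng.2 hcont)).div_const _
  · intro h
    refine left_ne_zero_of_mul hψ' (sub_eq_zero.2 ?_)
    exact congrArg Subtype.val h

open MeasureTheory in
/-- Continuous characters separate the points of a compact Hausdorff Abelian group. -/
theorem exists_continuousMonoidHom_circle_ne_one {G : Type*} [CommGroup G] [TopologicalSpace G]
    [IsTopologicalGroup G] [CompactSpace G] [T2Space G] {a : G} (ha : a ≠ 1) :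
    ∃ χ : G →* Circle, Continuous χ ∧ χ a ≠ 1 := by
  borelize G
  let μ : Measure G := Measure.haar
  let H := Lp ℂ 2 μ
  have : Fact ((2 : ENNReal) ≠ ⊤) := ⟨ENNReal.ofNat_ne_top⟩
  -- the regular representation
  let U : G → H →ₗᵢ[ℂ] H := fun g =>
    { DistribSMul.toLinearMap ℂ H (DomMulAct.mk g) with
      norm_map' := fun f => DomMulAct.norm_smul_Lp _ f }
  have hU : ∀ g (f : H), U g f = DomMulAct.mk g • f := fun g f => rfl
  have hUmul : ∀ g h (f : H), U (g * h) f = U g (U h f) := by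
    intro g h f
    rw [mul_comm, hU, hU, hU, DomMulAct.mk_mul, mul_smul]
  have hUone : ∀ f : H, U 1 f = f := by
    intro f
    rw [hU, DomMulAct.mk_one, one_smul]
  have hUinner : ∀ g (f f' : H), inner ℂ (U g f) f' = inner ℂ f (U g⁻¹ f') := by
    intro g f f'
    rw [← (U g).inner_map_map f, ← hUmul, mul_inv_cancel, hUone]
  have hUcont : ∀ f : H, Continuous fun g => U g f := by
    intro f
    have : Continuous fun g : G => DomMulAct.mk g := DomMulAct.continuous_mk
    exact this.smul continuous_const
  let π : G →* (H →L[ℂ] H) :=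
    { toFun := fun g => (U g).toContinuousLinearMap
      map_one' := by
        ext1 f
        exact hUone f
      map_mul' := fun g h => by
        ext1 f
        exact hUmul g h f }
  have hπ : ∀ g f, π g f = U g f := fun g f => rfl
  have hπstar : ∀ g, star (π g) = π g⁻¹ := by
    intro g
    rw [ContinuousLinearMap.star_eq_adjoint]
    symm
    rw [ContinuousLinearMap.eq_adjoint_iff]
    intro f f'
    rw [hπ, hπ, hUinner, inv_inv]
  -- matrix coefficients
  let K : H →L⋆[ℂ] H →L[ℂ] C(G, ℂ) := LinearMap.mkContinuous₂
    (LinearMap.mk₂'ₛₗ (starRingEnd ℂ) (RingHom.id ℂ)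
      (fun φ f => (⟨fun x => inner ℂ (U x⁻¹ φ) f,
        ((hUcont φ).comp continuous_inv).inner continuous_const⟩ : C(G, ℂ)))
      (fun φ φ' f => by
        ext x
        simp only [ContinuousMap.add_apply, ContinuousMap.coe_mk, map_add]
        exact inner_add_left (𝕜 := ℂ) (E := H) _ _ _)
      (fun c φ f => by ext x; simp [inner_smul_left])
      (fun φ f f' => by ext x; exact inner_add_right (𝕜 := ℂ) (E := H) _ _ _)
      (fun c φ f => by ext x; simp [inner_smul_right]))
    1 (fun φ f => by
      rw [one_mul, ContinuousMap.norm_le _ (by positivity)]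
      intro x
      refine (norm_inner_le_norm (𝕜 := ℂ) (E := H) _ _).trans_eq ?_
      rw [(U _).norm_map])
  have hK : ∀ φ f x, K φ f x = inner ℂ (U x⁻¹ φ) f := fun φ f x => rfl
  -- J φ is a convolution-type operator commuting with π. It depends norm continuously on φ, so g ↦
  -- J φ * π g = J (U g⁻¹ φ) is norm continuous.
  let J : H → H →L[ℂ] H := fun φ => (ContinuousMap.toLp 2 μ ℂ).comp (K φ)
  have hJcont : Continuous J := continuous_const.clm_comp K.continuous
  have hJU : ∀ φ g, J φ * π g = J (U g⁻¹ φ) := by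
    intro φ g
    ext1 f
    change ContinuousMap.toLp 2 μ ℂ (K φ (U g f)) = ContinuousMap.toLp 2 μ ℂ (K (U g⁻¹ φ) f)
    congr 1
    ext x
    rw [hK, hK, ← hUmul, mul_comm, hUmul, hUinner g⁻¹, inv_inv]
  have hUJ : ∀ φ g, π g * J φ = J (U g⁻¹ φ) := by
    intro φ g
    ext1 f
    change DomMulAct.mk g • ContinuousMap.toLp 2 μ ℂ (K φ f) =
      ContinuousMap.toLp 2 μ ℂ (K (U g⁻¹ φ) f)
    have hcomp : K (U g⁻¹ φ) f = (K φ f).comp ⟨fun x => g * x, continuous_const_mul g⟩ := by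
      ext x
      rw [ContinuousMap.comp_apply, hK, hK, ← hUmul, ContinuousMap.coe_mk, mul_inv_rev]
    rw [hcomp]
    rfl
  obtain ⟨V, hVo, h1V, hVa⟩ : ∃ V : Set G, IsOpen V ∧ 1 ∈ V ∧ V ∩ (a * ·) ⁻¹' V = ∅ := by
    obtain ⟨W, W', hW, hW', h1W, haW', hdisj⟩ := t2_separation ha.symm
    refine ⟨W ∩ (a * ·) ⁻¹' W', hW.inter (hW'.preimage (continuous_const_mul a)),
      ⟨h1W, by simpa using haW'⟩, eq_empty_iff_forall_notMem.2 ?_⟩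
    rintro x ⟨⟨-, hx⟩, ⟨hx', -⟩⟩
    exact disjoint_left.1 hdisj hx' hx
  -- V is disjoint from its translate, so φ is orthogonal to U a φ; if π a fixed T = (J φ)⋆ J φ,
  -- evaluating K φ (U a φ - φ) = 0 at 1 would give ⟨φ, φ⟩ = 0.
  let φ : H := indicatorConstLp 2 hVo.measurableSet (measure_ne_top μ V) 1
  have hφa : inner ℂ φ (U a φ) = 0 := by
    rw [hU, DomMulAct.mk_smul_indicatorConstLp, L2.inner_indicatorConstLp_one_indicatorConstLp_one]
    simp only [smul_eq_mul]
    rw [hVa]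
    simp
  have hφ : inner ℂ φ φ ≠ 0 := by
    rw [L2.inner_indicatorConstLp_one_indicatorConstLp_one, inter_self]
    have : μ.real V ≠ 0 :=
      (measureReal_ne_zero_iff (measure_ne_top μ V)).2 (hVo.measure_pos μ ⟨1, h1V⟩).ne'
    exact Complex.ofReal_ne_zero.2 this
  have hcomm : ∀ g, Commute (π g) (star (J φ) * J φ) := by
    intro g
    have h1 : ∀ g, Commute (π g) (J φ) := fun g => (hUJ φ g).trans (hJU φ g).symm
    refine Commute.mul_right ?_ (h1 g)
    have := (h1 g⁻¹).star_star
    rwa [hπstar, inv_inv] at this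
  refine exists_continuousMonoidHom_circle_of_unitary_rep π hπstar (star (J φ) * J φ)
    (by rw [star_mul, star_star]) hcomm ?_ (a := a) ?_
  · have heq : (fun g => π g * (star (J φ) * J φ)) = fun g => star (J φ) * J (U g⁻¹ φ) := by
      ext1 g
      rw [(hcomm g).eq, mul_assoc, hJU]
    rw [heq]
    exact continuous_const.mul (hJcont.comp ((hUcont φ).comp continuous_inv))
  · intro h
    rw [(hcomm a).eq] at h
    have h0 : star (J φ * (π a - 1)) * (J φ * (π a - 1)) = 0 := by
      rw [star_mul, mul_assoc, ← mul_assoc (star (J φ)), mul_sub, h, mul_one, sub_self, mul_zero]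
    have h1 : J φ * (π a - 1) = 0 := CStarRing.star_mul_self_eq_zero_iff _ |>.1 h0
    have h2 : ContinuousMap.toLp 2 μ ℂ (K φ (U a φ - φ)) = 0 := DFunLike.congr_fun h1 φ
    have h3 : K φ (U a φ - φ) = 0 :=
      ContinuousMap.toLp_injective (p := 2) (𝕜 := ℂ) μ (h2.trans (map_zero _).symm)
    have h4 := DFunLike.congr_fun h3 1
    rw [hK, inv_one, hUone, inner_sub_right, hφa, zero_sub] at h4
    exact hφ (neg_eq_zero.1 h4)

/-! ### The two classes of groups -/

theorem IsZeroDimensional.exists_openNormalSubgroup_notMem {G : Type*} [Group G]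
    [TopologicalSpace G] [IsTopologicalGroup G] [CompactSpace G] [T2Space G]
    (h : IsZeroDimensional G) {a : G} (ha : a ≠ 1) : ∃ U : OpenNormalSubgroup G, a ∉ U := by
  obtain ⟨W, hW, h1W, hWa⟩ := h.exists_subset_of_mem_open (a := 1) (u := {a}ᶜ)
    (fun h1a => ha h1a.symm) isOpen_compl_singleton
  obtain ⟨U, hU⟩ := IsTopologicalGroup.exist_openNormalSubgroup_sub_clopen_nhds_of_one hW h1W
  exact ⟨U, fun haU => hWa (hU haU) rfl⟩

theorem inf_ker_lt {G Q : Type*} [Group G] [Group Q] {N : Subgroup G} (q : G →* Q) {a : G}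
    (haN : a ∈ N) (hqa : q a ≠ 1) : N ⊓ q.ker < N :=
  lt_of_le_of_ne inf_le_left fun heq => hqa (heq.ge haN).2

theorem mainTheorem6 :
    (∀ (G : Type*) [CommGroup G] [TopologicalSpace G] [IsTopologicalGroup G]
        [CompactSpace G] [T2Space G],
      ∃ ℬ : Set (Set G), IsClosedSubbase ℬ ∧ IsBinaryFamily ℬ ∧ IsTranslationInvariant ℬ) ∧
    (∀ (G : Type*) [Group G] [TopologicalSpace G] [IsTopologicalGroup G]
        [CompactSpace G] [T2Space G], IsZeroDimensional G →
      ∃ ℬ : Set (Set G), IsClosedSubbase ℬ ∧ IsBinaryFamily ℬ ∧ IsTranslationInvariant ℬ) := by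
  refine ⟨fun G _ _ _ _ _ => exists_binary_subbase_of_step fun N ℬ hN h hbot => ?_,
    fun G _ _ _ _ _ hG => exists_binary_subbase_of_step fun N ℬ hN h hbot => ?_⟩
  · obtain ⟨⟨a, haN⟩, ha⟩ := N.ne_bot_iff_exists_ne_one.1 hbot
    obtain ⟨χ, hχ, hχa⟩ := exists_continuousMonoidHom_circle_ne_one (a := a)
      fun h1 => ha (Subtype.ext h1)
    refine ⟨N ⊓ χ.ker, inf_ker_lt χ haN hχa,
      hN.inter (isClosed_singleton.preimage hχ : IsClosed (χ ⁻¹' {1})), ?_⟩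
    have hclosed : IsClosed (N.map χ : Set Circle) := by
      rw [Subgroup.coe_map]
      exact (hN.isCompact.image hχ).isClosed
    rcases Circle.subgroup_discrete_or_eq_top _ hclosed with ⟨D, hD, hDN⟩ | htop
    · exact h.exists_superset_inf_ker_of_discrete χ hχ hD fun n hn =>
        hDN _ (Subgroup.mem_map_of_mem χ hn)
    · refine ⟨_, subset_union_left, h.inf_ker_of_surjective χ hχ (fun t => ?_)
        isCosetSubbase_shortArcs⟩
      exact Subgroup.mem_map.1 (htop ▸ Subgroup.mem_top t)
  · obtain ⟨⟨a, haN⟩, ha⟩ := N.ne_bot_iff_exists_ne_one.1 hbot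
    obtain ⟨U, haU⟩ := hG.exists_openNormalSubgroup_notMem (a := a) fun h1 => ha (Subtype.ext h1)
    let q := QuotientGroup.mk' U.toSubgroup
    have hq : Continuous q := continuous_quot_mk
    have : DiscreteTopology (G ⧸ U.toSubgroup) := QuotientGroup.discreteTopology U.isOpen'
    refine ⟨N ⊓ q.ker, inf_ker_lt q haN fun h1 => haU ((QuotientGroup.eq_one_iff a).1 h1),
      hN.inter (isClosed_singleton.preimage hq : IsClosed (q ⁻¹' {1})), ?_⟩
    exact h.exists_superset_inf_ker_of_discrete q hq (D := {1}) (by simp) fun n _ hn => hn
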